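/- Let $G$ be a simplicial group with faces $d_i$ and degeneracies $s_i$, and let $n \ge 2$. Write $[n-1]=\{0,\dots,n-1\}$, let $N_nG=\bigcap_{i=0}^{n-1}\ker(d_i\colon G_n\to G_{n-1})$ be the $n$-th term of the Moore complex of $G$, with differential $d$ induced by $d_n$, and for $I\subseteq[n-1]$ put $K_I=\bigcap_{i\in I}\ker(d_i\colon G_{n-1}\to G_{n-2})$. Suppose that the group $G_n$ is generated by its degenerate elements, i.e. by the elements $s_i(x)$ with $x\in G_{n-1}$ and $0\le i\le n-1$. Then $$d(N_nG)=\prod_{I,J}\,[K_I,K_J],$$ the product (inside $G_{n-1}$) of the commutator subgroups $[K_I,K_J]$ over all non-empty subsets $I,J\subseteq[n-1]$ with $I\cup J=[n-1]$. -/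

import Mathlib

open CategoryTheory
open scoped Simplicial

universe u

namespace SimplicialGroup

/-- For a simplicial group `G` and a set `I` of face indices in `{0, …, n + 1}`, the subgroup
`K_I = ⋂_{i ∈ I} ker (d_i : G_{n+1} → G_n)` of `G_{n+1}`. -/
def faceKer (G : SimplicialObject GrpCat.{u}) (n : ℕ) (I : Set (Fin (n + 2))) :
    Subgroup (G _⦋n + 1⦌) :=
  ⨅ i ∈ I, (G.δ i).hom.ker

/-- The terms of the Moore complex: `N_0 G = G_0`, and
`N_{n+1} G = ⋂_{i = 0}^{n} ker (d_i : G_{n+1} → G_n)` (all faces but the last one). -/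
def moore (G : SimplicialObject GrpCat.{u}) (n : ℕ) : Subgroup (G _⦋n⦌) :=
  match n with
  | 0 => ⊤
  | n + 1 => ⨅ i : Fin (n + 1), (G.δ i.castSucc).hom.ker

/-- The image `d(N_{n+1} G)`, as a subgroup of `G_n`; the differential of the Moore complex
is induced by the last face `d_{n+1} : G_{n+1} → G_n`. -/
def mooreBoundary (G : SimplicialObject GrpCat.{u}) (n : ℕ) : Subgroup (G _⦋n⦌) :=
  (moore G (n + 1)).map (G.δ (Fin.last (n + 1))).hom

/-- The subgroup `D_{n+1}` of `G_{n+1}` generated by the degenerate elements, that is, by the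
elements `s_i x` with `x ∈ G_n` and `0 ≤ i ≤ n`. -/
def degenerateSubgroup (G : SimplicialObject GrpCat.{u}) (n : ℕ) : Subgroup (G _⦋n + 1⦌) :=
  Subgroup.closure {y | ∃ (i : Fin (n + 1)) (x : G _⦋n⦌), (G.σ i).hom x = y}

/-- The product of the commutator subgroups `[K_I, K_J]` of `G_{n+1}` over all non-empty
`I, J ⊆ {0, …, n + 1}` with `I ∪ J = {0, …, n + 1}`. All factors are normal subgroups of
`G_{n+1}`, so that their product, in any order, is their supremum. -/
def commutatorProduct (G : SimplicialObject GrpCat.{u}) (n : ℕ) : Subgroup (G _⦋n + 1⦌) :=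
  ⨆ (I : Set (Fin (n + 2))) (J : Set (Fin (n + 2)))
    (_ : I.Nonempty) (_ : J.Nonempty) (_ : I ∪ J = Set.univ),
    ⁅faceKer G n I, faceKer G n J⁆

end SimplicialGroup

/-! The maps `p_i = s_i d_i` on `G_n` are idempotents with the kernel of `d_i` and the image of
`s_i`. Write `z ∈ N_n G` as a product of degenerate elements and split words by `x = p_k x · ((p_k
x)⁻¹ x)` for `k = 0, …, n-1` in turn. As `p_k z = 1`, only the second factor survives, and its
support gains `k`. A basic element always misses an index, so full support at the end arises only
through commutators; thus `z` is a product of elements of the `[K_I, K_J]` upstairs, which `d_n`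
maps into those downstairs (`mooreBoundary_le`).

Conversely, for any `G`, covers may be shrunk to proper `I, J`. Elements of `K_I, K_J` then lift to
`a, b` by horn filling, and `[a, b]` lies in `N_n G` (`commutatorProduct_le`). -/

namespace SimplicialGroup

open scoped commutatorElement

/-! ### Commutator words and families of idempotents -/

section IdempotentFamily

variable {Γ : Type*} [Group Γ] {N : ℕ}

/-- Products of iterated commutators of elements supported on faces `< k`: a basic element
supported on `I` is killed by every `p i` with `i ∈ I`, and comes from some index `j ∉ I`, in the
sense that either `j < k`, or it is fixed by `p j`. Supports add up under commutators. -/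
inductive IsCommutatorWord (p : Fin N → Γ →* Γ) (k : ℕ) : Set (Fin N) → Γ → Prop where
  /-- the trivial word -/
  | one {I : Set (Fin N)} (hI : ∀ i ∈ I, i.val < k) : IsCommutatorWord p k I 1
  /-- basic elements -/
  | basic {I : Set (Fin N)} {x : Γ} {j : Fin N} (hI : ∀ i ∈ I, i.val < k)
      (hx : ∀ i ∈ I, p i x = 1) (hj : j ∉ I) (h : j.val < k ∨ p j x = x) :
      IsCommutatorWord p k I x
  /-- products, for a fixed support -/
  | mul {I : Set (Fin N)} {x y : Γ} :
      IsCommutatorWord p k I x → IsCommutatorWord p k I y → IsCommutatorWord p k I (x * y)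
  /-- inverses -/
  | inv {I : Set (Fin N)} {x : Γ} : IsCommutatorWord p k I x → IsCommutatorWord p k I x⁻¹
  /-- commutators -/
  | comm {I J : Set (Fin N)} {x y : Γ} :
      IsCommutatorWord p k I x → IsCommutatorWord p k J y → IsCommutatorWord p k (I ∪ J) ⁅x, y⁆

namespace IsCommutatorWord

variable {p : Fin N → Γ →* Γ}

theorem support_lt {k : ℕ} {I : Set (Fin N)} {x : Γ} (h : IsCommutatorWord p k I x) :
    ∀ i ∈ I, i.val < k := by
  induction h with
  | one hI => exact hI
  | basic hI => exact hI
  | mul _ _ ih _ => exact ih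
  | inv _ ih => exact ih
  | comm _ _ ih₁ ih₂ => exact fun i hi => hi.elim (ih₁ i) (ih₂ i)

/-- Since `a b a⁻¹ = [a, b] b`, conjugation creates no new support. -/
theorem conj {k : ℕ} {I J : Set (Fin N)} {a b : Γ} (ha : IsCommutatorWord p k I a)
    (hb : IsCommutatorWord p k J b) (hIJ : I ⊆ J) : IsCommutatorWord p k J (a * b * a⁻¹) := by
  have h := ha.comm hb
  rw [Set.union_eq_self_of_subset_left hIJ] at h
  simpa [commutatorElement_def] using h.mul hb

/-- Splitting a word by the idempotent `p k`. -/
theorem split (hidem : ∀ k x, p k (p k x) = p k x)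
    (hker : ∀ i k, i < k → ∀ x, p i x = 1 → p i (p k x) = 1)
    (hrange : ∀ k j, k < j → ∀ x, p j x = x → p j (p k x) = p k x)
    (k : Fin N) {I : Set (Fin N)} {x : Γ} (h : IsCommutatorWord p k I x) :
    IsCommutatorWord p (k + 1) I (p k x) ∧
      IsCommutatorWord p (k + 1) (insert k I) ((p k x)⁻¹ * x) := by
  have hlt {I : Set (Fin N)} (hI : ∀ i ∈ I, i.val < k.val) : ∀ i ∈ I, i.val < k.val + 1 :=
    fun i hi => (hI i hi).trans (Nat.lt_succ_self _)
  have hlt' {I : Set (Fin N)} (hI : ∀ i ∈ I, i.val < k.val) :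
      ∀ i ∈ insert k I, i.val < k.val + 1 := by
    rintro i (rfl | hi)
    · exact Nat.lt_succ_self _
    · exact hlt hI i hi
  induction h with
  | one hI => exact ⟨by simpa using one (hlt hI), by simpa using one (hlt' hI)⟩
  | @basic I x j hI hx hj h =>
    have hpx : ∀ i ∈ I, p i (p k x) = 1 := fun i hi => hker i k (hI i hi) x (hx i hi)
    have hqx : ∀ i ∈ insert k I, p i ((p k x)⁻¹ * x) = 1 := by
      rintro i (rfl | hi)
      · simp [hidem]
      · simp [hpx i hi, hx i hi]
    -- The missing index `j` is lost only if `j = k`, but then `p k x = x` and the second factor is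
    -- trivial.
    rcases lt_trichotomy j k with hjk | rfl | hjk
    · refine ⟨basic (hlt hI) hpx hj (.inl (Nat.lt_succ_of_lt hjk)),
        basic (hlt' hI) hqx (j := j) ?_ (.inl (Nat.lt_succ_of_lt hjk))⟩
      rintro (rfl | hj')
      exacts [lt_irrefl _ hjk, hj hj']
    · have hjx : p j x = x := h.resolve_left (lt_irrefl _)
      refine ⟨basic (hlt hI) hpx hj (.inl (Nat.lt_succ_self _)), ?_⟩
      simpa [hjx] using one (hlt' hI)
    · have hjx : p j x = x := h.resolve_left (not_lt.2 (le_of_lt hjk))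
      have hpj := hrange k j hjk x hjx
      refine ⟨basic (hlt hI) hpx hj (.inr hpj),
        basic (hlt' hI) hqx (j := j) ?_ (.inr (by simp [hpj, hjx]))⟩
      rintro (rfl | hj')
      exacts [lt_irrefl _ hjk, hj hj']
  | @mul I x y _ _ ihx ihy =>
    refine ⟨by simpa using ihx.1.mul ihy.1, ?_⟩
    have h := (ihy.1.inv.conj ihx.2 (Set.subset_insert k I)).mul ihy.2
    convert h using 1
    simp only [map_mul]
    group
  | @inv I x _ ih =>
    refine ⟨by simpa using ih.1.inv, ?_⟩
    have h := ih.1.conj ih.2.inv (Set.subset_insert k I)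
    convert h using 1
    simp only [map_inv]
    group
  | @comm I J x y hx hy ihx ihy =>
    refine ⟨by simpa using ihx.1.comm ihy.1, ?_⟩
    have e₁ : insert k I ∪ J = insert k (I ∪ J) := Set.insert_union
    have e₂ : I ∪ insert k J = insert k (I ∪ J) := Set.union_insert
    have e₃ : insert k I ∪ insert k J = insert k (I ∪ J) := by
      rw [Set.insert_union, Set.union_insert, Set.insert_idem]
    have c₁ := ihx.2.comm ihy.1
    have c₂ := ihx.1.comm ihy.2
    have c₃ := ihx.2.comm ihy.2
    rw [e₁] at c₁
    rw [e₂] at c₂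
    rw [e₃] at c₃
    have sI : I ⊆ insert k (I ∪ J) := Set.subset_union_left.trans (Set.subset_insert _ _)
    have sJ : J ⊆ insert k (I ∪ J) := Set.subset_union_right.trans (Set.subset_insert _ _)
    -- With `x = a u`, `y = b v`, `a = p k x`, `b = p k y`: `[a,b]⁻¹ [au,bv]` is `a [u,b] (b [u,v]
    -- b⁻¹) a⁻¹`, conjugated by `[a,b]⁻¹`, times `b [a,v] b⁻¹`.
    have h := ((ihx.1.comm ihy.1).inv.conj
      (ihx.1.conj (c₁.mul (ihy.1.conj c₃ sJ)) sI) (Set.subset_insert _ _)).mul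
      (ihy.1.conj c₂ sJ)
    convert h using 1
    simp only [commutatorElement_def, map_mul, map_inv]
    group

end IsCommutatorWord

/-- The common kernel of the `p i`, `i ∈ I`. -/
def commonKer (p : Fin N → Γ →* Γ) (I : Set (Fin N)) : Subgroup Γ :=
  ⨅ i ∈ I, (p i).ker

theorem mem_commonKer {p : Fin N → Γ →* Γ} {I : Set (Fin N)} {x : Γ} :
    x ∈ commonKer p I ↔ ∀ i ∈ I, p i x = 1 := by
  simp [commonKer, Subgroup.mem_iInf, MonoidHom.mem_ker]

instance (p : Fin N → Γ →* Γ) (I : Set (Fin N)) : (commonKer p I).Normal :=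
  Subgroup.normal_iInf_normal fun _ => Subgroup.normal_iInf_normal fun _ => inferInstance

/-- The product of the commutators `[K_I, K_J]` of common kernels over all covers of the index
set by two non-empty subsets. -/
def kerCommutators (p : Fin N → Γ →* Γ) : Subgroup Γ :=
  ⨆ (I : Set (Fin N)) (J : Set (Fin N)) (_ : I.Nonempty) (_ : J.Nonempty)
    (_ : I ∪ J = Set.univ), ⁅commonKer p I, commonKer p J⁆

instance (p : Fin N → Γ →* Γ) : (kerCommutators p).Normal := by
  unfold kerCommutators
  infer_instance

theorem IsCommutatorWord.mem_kerCommutators {p : Fin N → Γ →* Γ} {I : Set (Fin N)} {x : Γ}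
    (h : IsCommutatorWord p N I x) :
    x ∈ commonKer p I ∧ (I = Set.univ → x ∈ kerCommutators p) := by
  induction h with
  | one => exact ⟨one_mem _, fun _ => one_mem _⟩
  | basic hI hx hj h => exact ⟨mem_commonKer.2 hx, fun e => (hj (e ▸ Set.mem_univ _)).elim⟩
  | mul _ _ ihx ihy =>
    exact ⟨mul_mem ihx.1 ihy.1, fun e => mul_mem (ihx.2 e) (ihy.2 e)⟩
  | inv _ ih => exact ⟨inv_mem ih.1, fun e => inv_mem (ih.2 e)⟩
  | @comm I J x y _ _ ihx ihy =>
    refine ⟨mem_commonKer.2 ?_, fun e => ?_⟩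
    · rintro i (hi | hi)
      · simp [map_commutatorElement, mem_commonKer.1 ihx.1 i hi]
      · simp [map_commutatorElement, mem_commonKer.1 ihy.1 i hi]
    -- If one support is empty, the other is full, and normality suffices.
    · rcases I.eq_empty_or_nonempty with rfl | hI
      · rw [Set.empty_union] at e
        exact Subgroup.commutator_le_right ⊤ _
          (Subgroup.commutator_mem_commutator (Subgroup.mem_top x) (ihy.2 e))
      rcases J.eq_empty_or_nonempty with rfl | hJ
      · rw [Set.union_empty] at e
        exact Subgroup.commutator_le_left _ ⊤
          (Subgroup.commutator_mem_commutator (ihx.2 e) (Subgroup.mem_top y))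
      have hle : ⁅commonKer p I, commonKer p J⁆ ≤ kerCommutators p :=
        le_iSup_of_le I <| le_iSup_of_le J <| le_iSup_of_le hI <| le_iSup_of_le hJ <|
          le_iSup_of_le e le_rfl
      exact hle (Subgroup.commutator_mem_commutator ihx.1 ihy.1)

/-- If a group is generated by the images of idempotent endomorphisms `p 0, …, p (N - 1)` such
that `p k` preserves the kernel of `p i` for `i < k` and the image of `p j` for `k < j`, then the
common kernel of all `p i` is contained in the product of the commutators `[K_I, K_J]`. -/
theorem commonKer_univ_le_kerCommutators {p : Fin N → Γ →* Γ}
    (hidem : ∀ k x, p k (p k x) = p k x)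
    (hker : ∀ i k, i < k → ∀ x, p i x = 1 → p i (p k x) = 1)
    (hrange : ∀ k j, k < j → ∀ x, p j x = x → p j (p k x) = p k x)
    (hgen : Subgroup.closure {x | ∃ j, p j x = x} = ⊤) :
    commonKer p Set.univ ≤ kerCommutators p := by
  intro z hz
  rw [mem_commonKer] at hz
  have key : ∀ k ≤ N, IsCommutatorWord p k {i | i.val < k} z := by
    intro k
    induction k with
    | zero =>
      intro _
      clear hz
      have e : ({i | i.val < 0} : Set (Fin N)) = ∅ := by ext; simp
      rw [e]
      have hz' : z ∈ Subgroup.closure {x | ∃ j, p j x = x} := hgen ▸ Subgroup.mem_top z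
      induction hz' using Subgroup.closure_induction with
      | mem x hx =>
        obtain ⟨j, hj⟩ := hx
        exact .basic (j := j) (by simp) (by simp) (by simp) (.inr hj)
      | one => exact .one (by simp)
      | mul x y _ _ hx hy => exact hx.mul hy
      | inv x _ hx => exact hx.inv
    | succ k ih =>
      intro hk
      have h := ((ih (by omega)).split hidem hker hrange ⟨k, hk⟩).2
      rw [hz ⟨k, hk⟩ (Set.mem_univ _), inv_one, one_mul] at h
      convert h using 1
      ext i
      simp only [Set.mem_ofPred_eq, Set.mem_insert_iff, Fin.ext_iff]
      omega
  refine (key N le_rfl).mem_kerCommutators.2 ?_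
  ext i
  simp

end IdempotentFamily

/-! ### Simplicial identities and the idempotents `s_i d_i` -/

section Identities

variable (G : SimplicialObject GrpCat.{u}) {n : ℕ}

theorem face_degen_of_le {i : Fin (n + 2)} {j : Fin (n + 1)} (h : i ≤ j.castSucc)
    (x : G _⦋n + 1⦌) :
    (G.δ i.castSucc).hom ((G.σ j.succ).hom x) = (G.σ j).hom ((G.δ i).hom x) :=
  ConcreteCategory.congr_hom (G.δ_comp_σ_of_le h) x

theorem face_degen_self (i : Fin (n + 1)) (x : G _⦋n⦌) :
    (G.δ i.castSucc).hom ((G.σ i).hom x) = x :=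
  ConcreteCategory.congr_hom (G.δ_comp_σ_self (i := i)) x

theorem face_degen_succ (i : Fin (n + 1)) (x : G _⦋n⦌) :
    (G.δ i.succ).hom ((G.σ i).hom x) = x :=
  ConcreteCategory.congr_hom (G.δ_comp_σ_succ (i := i)) x

theorem face_degen_of_gt {i : Fin (n + 2)} {j : Fin (n + 1)} (h : j.castSucc < i)
    (x : G _⦋n + 1⦌) :
    (G.δ i.succ).hom ((G.σ j.castSucc).hom x) = (G.σ j).hom ((G.δ i).hom x) :=
  ConcreteCategory.congr_hom (G.δ_comp_σ_of_gt h) x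

theorem face_face {i j : Fin (n + 2)} (h : i ≤ j) (x : G _⦋n + 2⦌) :
    (G.δ i).hom ((G.δ j.succ).hom x) = (G.δ j).hom ((G.δ i.castSucc).hom x) :=
  ConcreteCategory.congr_hom (G.δ_comp_δ h) x

theorem degen_degen {i j : Fin (n + 1)} (h : i ≤ j) (x : G _⦋n⦌) :
    (G.σ i.castSucc).hom ((G.σ j).hom x) = (G.σ j.succ).hom ((G.σ i).hom x) :=
  ConcreteCategory.congr_hom (G.σ_comp_σ h) x

end Identities

variable {G : SimplicialObject GrpCat.{u}} {m : ℕ}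

theorem mem_faceKer {I : Set (Fin (m + 2))} {x : G _⦋m + 1⦌} :
    x ∈ faceKer G m I ↔ ∀ i ∈ I, (G.δ i).hom x = 1 := by
  simp [faceKer, Subgroup.mem_iInf, MonoidHom.mem_ker]

theorem mem_moore_succ {x : G _⦋m + 1⦌} :
    x ∈ moore G (m + 1) ↔ ∀ i : Fin (m + 1), (G.δ i.castSucc).hom x = 1 := by
  simp [moore, Subgroup.mem_iInf, MonoidHom.mem_ker]

theorem faceKer_anti {I J : Set (Fin (m + 2))} (h : I ⊆ J) : faceKer G m J ≤ faceKer G m I :=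
  fun _ hx => mem_faceKer.2 fun i hi => mem_faceKer.1 hx i (h hi)

/-- The idempotent `s_i d_i`. -/
def degenFace (G : SimplicialObject GrpCat.{u}) (m : ℕ) (i : Fin (m + 2)) :
    G _⦋m + 2⦌ →* G _⦋m + 2⦌ :=
  (G.σ i).hom.comp (G.δ i.castSucc).hom

theorem degenFace_apply (i : Fin (m + 2)) (x : G _⦋m + 2⦌) :
    degenFace G m i x = (G.σ i).hom ((G.δ i.castSucc).hom x) := rfl

theorem degenFace_eq_one_iff {i : Fin (m + 2)} {x : G _⦋m + 2⦌} :
    degenFace G m i x = 1 ↔ (G.δ i.castSucc).hom x = 1 := by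
  refine ⟨fun h => ?_, fun h => by rw [degenFace_apply, h, map_one]⟩
  rw [← face_degen_self G i ((G.δ i.castSucc).hom x), ← degenFace_apply, h, map_one]

theorem degenFace_degen (i : Fin (m + 2)) (x : G _⦋m + 1⦌) :
    degenFace G m i ((G.σ i).hom x) = (G.σ i).hom x := by
  rw [degenFace_apply, face_degen_self]

/-- For `i < k`, `d_i s_k d_k = s_{k-1} d_{k-1} d_i`. -/
theorem degenFace_eq_one_of_lt {i k : Fin (m + 2)} (h : i < k) {x : G _⦋m + 2⦌}
    (hx : degenFace G m i x = 1) : degenFace G m i (degenFace G m k x) = 1 := by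
  rw [degenFace_eq_one_iff] at hx ⊢
  obtain ⟨k, rfl⟩ := Fin.exists_succ_eq.2 (Fin.ne_zero_of_lt h)
  have hik : i ≤ k.castSucc := Fin.le_castSucc_iff.2 h
  rw [degenFace_apply, face_degen_of_le G hik, ← Fin.succ_castSucc, face_face G hik, hx, map_one,
    map_one]

/-- For `k < j`, `s_k d_k s_j = s_k s_{j-1} d_k = s_j s_k d_k`. -/
theorem degenFace_degenFace_of_lt {k j : Fin (m + 2)} (h : k < j) {x : G _⦋m + 2⦌}
    (hx : degenFace G m j x = x) : degenFace G m j (degenFace G m k x) = degenFace G m k x := by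
  obtain ⟨j, rfl⟩ := Fin.exists_succ_eq.2 (Fin.ne_zero_of_lt h)
  obtain ⟨k, rfl⟩ := Fin.exists_castSucc_eq.2 (Fin.ne_last_of_lt h)
  have hkj : k.castSucc ≤ j.castSucc := Fin.le_castSucc_iff.2 h
  have e : degenFace G m k.castSucc x = (G.σ j.succ).hom ((G.σ k).hom
      ((G.δ k.castSucc).hom ((G.δ j.succ.castSucc).hom x))) := by
    rw [← degen_degen G (Fin.castSucc_le_castSucc_iff.1 hkj), ← face_degen_of_le G hkj,
      ← degenFace_apply j.succ, hx, ← degenFace_apply]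
  rw [e, degenFace_degen]

theorem map_commonKer_le (I : Set (Fin (m + 2))) :
    (commonKer (degenFace G m) I).map (G.δ (Fin.last (m + 2))).hom ≤ faceKer G m I := by
  rintro _ ⟨x, hx, rfl⟩
  refine mem_faceKer.2 fun i hi => ?_
  have h : (G.δ i.castSucc).hom x = 1 := degenFace_eq_one_iff.1 (mem_commonKer.1 hx i hi)
  rw [← Fin.succ_last, face_face G (Fin.le_last i), h, map_one]

theorem mooreBoundary_le (hG : degenerateSubgroup G (m + 1) = ⊤) :
    mooreBoundary G (m + 1) ≤ commutatorProduct G m := by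
  have hgen : Subgroup.closure {x | ∃ j, degenFace G m j x = x} = ⊤ := by
    refine top_le_iff.1 (hG.ge.trans (Subgroup.closure_mono ?_))
    rintro _ ⟨i, x, rfl⟩
    exact ⟨i, degenFace_degen i x⟩
  have hle := commonKer_univ_le_kerCommutators (p := degenFace G m)
    (fun k x => degenFace_degen k _) (fun i k h x => degenFace_eq_one_of_lt h)
    (fun k j h x => degenFace_degenFace_of_lt h) hgen
  have hmoore : moore G (m + 2) ≤ commonKer (degenFace G m) Set.univ := fun x hx =>
    mem_commonKer.2 fun i _ => degenFace_eq_one_iff.2 (mem_moore_succ.1 hx i)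
  refine (Subgroup.map_mono (hmoore.trans hle)).trans ?_
  simp only [kerCommutators, Subgroup.map_iSup, Subgroup.map_commutator]
  exact iSup_mono fun I => iSup_mono fun J => iSup_mono fun _ => iSup_mono fun _ =>
    iSup_mono fun _ => Subgroup.commutator_mono (map_commonKer_le I) (map_commonKer_le J)

/-! ### Horn filling and the reverse inclusion -/

/-- Filling a horn with trivial faces: if `I` is a proper set of face indices, an element of
`K_I` lifts along the last face to an element killed by the faces with indices in `I`. -/
theorem exists_lift_of_mem_faceKer {I : Set (Fin (m + 2))} (hI : I ≠ Set.univ)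
    {x : G _⦋m + 1⦌} (hx : x ∈ faceKer G m I) :
    ∃ a : G _⦋m + 2⦌, (∀ i ∈ I, (G.δ i.castSucc).hom a = 1) ∧
      (G.δ (Fin.last (m + 2))).hom a = x := by
  rw [mem_faceKer] at hx
  obtain ⟨k, hk, hmax⟩ : ∃ k ∉ I, ∀ i, k < i → i ∈ I := by
    obtain ⟨k, hk⟩ := (Set.toFinite Iᶜ).exists_maximal (Set.nonempty_compl.2 hI)
    refine ⟨k, hk.1, fun i hi => ?_⟩
    by_contra hiI
    exact hi.not_ge (hk.2 hiI hi.le)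
  have hlow : ∀ j : Fin (m + 2), ∀ i ∈ I, i < j → (G.δ i.castSucc).hom ((G.σ j).hom x) = 1 := by
    intro j i hi hij
    obtain ⟨j, rfl⟩ := Fin.exists_succ_eq.2 (Fin.ne_zero_of_lt hij)
    rw [face_degen_of_le G (Fin.le_castSucc_iff.2 hij), hx i hi, map_one]
  have hhigh : ∀ j : Fin (m + 2), k ≤ j → ∀ i : Fin (m + 2), j < i →
      (G.δ i.succ).hom ((G.σ j).hom x) = 1 := by
    intro j hkj i hij
    obtain ⟨j, rfl⟩ := Fin.exists_castSucc_eq.2 (Fin.ne_last_of_lt hij)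
    rw [face_degen_of_gt G hij, hx i (hmax i (hkj.trans_lt hij)), map_one]
  -- Start from `s_k x` and replace `a` by `s_j x · a⁻¹` for each `j > k`: both factors have `j`-th
  -- face `x`, so it cancels and `x` moves on to face `j + 1`.
  have key : ∀ j : Fin (m + 2), k ≤ j → ∃ a : G _⦋m + 2⦌,
      (∀ i ∈ I, i ≤ j → (G.δ i.castSucc).hom a = 1) ∧ (G.δ j.succ).hom a = x ∧
      ∀ i, j < i → (G.δ i.succ).hom a = 1 := by
    intro j
    induction j using Fin.induction with
    | zero =>
      intro hkj
      obtain rfl : k = 0 := Fin.le_zero_iff.1 hkj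
      refine ⟨(G.σ 0).hom x, fun i hi h => ?_, face_degen_succ G 0 x, hhigh 0 le_rfl⟩
      exact (hk (Fin.le_zero_iff.1 h ▸ hi)).elim
    | succ j ih =>
      intro hkj
      rcases hkj.eq_or_lt with rfl | hlt
      · refine ⟨(G.σ j.succ).hom x, fun i hi h => hlow _ i hi (h.lt_of_ne ?_),
          face_degen_succ G _ x, hhigh _ le_rfl⟩
        rintro rfl
        exact hk hi
      · obtain ⟨a, h₁, h₂, h₃⟩ := ih (Fin.le_castSucc_iff.2 hlt)
        have hj : j.castSucc < j.succ := Fin.castSucc_lt_succ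
        refine ⟨(G.σ j.succ).hom x * a⁻¹, fun i hi h => ?_, ?_, fun i hi => ?_⟩
        · rcases h.eq_or_lt with rfl | h
          · rw [map_mul, map_inv, face_degen_self, ← Fin.succ_castSucc, h₂, mul_inv_cancel]
          · rw [map_mul, map_inv, hlow _ i hi h, h₁ i hi (Fin.le_castSucc_iff.2 h), inv_one,
              mul_one]
        · rw [map_mul, map_inv, face_degen_succ, h₃ _ hj, inv_one, mul_one]
        · rw [map_mul, map_inv, hhigh _ hkj i hi, h₃ i (hj.trans hi), inv_one, mul_one]
  obtain ⟨a, h₁, h₂, -⟩ := key (Fin.last (m + 1)) (Fin.le_last k)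
  exact ⟨a, fun i hi => h₁ i hi (Fin.le_last i), h₂⟩

theorem commutator_faceKer_le_of_ne_univ {I J : Set (Fin (m + 2))} (hI : I ≠ Set.univ)
    (hJ : J ≠ Set.univ) (hIJ : I ∪ J = Set.univ) :
    ⁅faceKer G m I, faceKer G m J⁆ ≤ mooreBoundary G (m + 1) := by
  rw [Subgroup.commutator_le]
  intro x hx y hy
  obtain ⟨a, ha, rfl⟩ := exists_lift_of_mem_faceKer hI hx
  obtain ⟨b, hb, rfl⟩ := exists_lift_of_mem_faceKer hJ hy
  refine ⟨(⁅a, b⁆ : G _⦋m + 2⦌), mem_moore_succ.2 fun i => ?_, map_commutatorElement _ _ _⟩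
  rw [map_commutatorElement]
  rcases (hIJ ▸ Set.mem_univ i : i ∈ I ∪ J) with hi | hi
  · rw [ha i hi, commutatorElement_one_left]
  · rw [hb i hi, commutatorElement_one_right]

/-- A cover by two non-empty sets shrinks to a cover by two proper subsets. -/
theorem exists_proper_cover {ι : Type*} [Nontrivial ι] {I J : Set ι} (hI : I.Nonempty)
    (hJ : J.Nonempty) (hIJ : I ∪ J = Set.univ) :
    ∃ I' ⊆ I, ∃ J' ⊆ J, I' ≠ Set.univ ∧ J' ≠ Set.univ ∧ I' ∪ J' = Set.univ := by
  by_cases h : J = Set.univ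
  · obtain ⟨i, hi⟩ := hI
    refine ⟨{i}, by simpa using hi, {i}ᶜ, by simp [h], Set.singleton_ne_univ i, ?_,
      Set.union_compl_self _⟩
    simp
  · obtain ⟨j, hj⟩ := hJ
    refine ⟨I \ {j}, Set.sdiff_subset, J, subset_rfl, fun e => ?_, h, ?_⟩
    · have : j ∈ I \ {j} := e ▸ Set.mem_univ j
      exact this.2 rfl
    · refine Set.eq_univ_of_forall fun i => ?_
      by_cases hij : i = j
      · exact .inr (hij ▸ hj)
      · exact (hIJ ▸ Set.mem_univ i : i ∈ I ∪ J).imp (fun hi => ⟨hi, hij⟩) id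

theorem commutatorProduct_le : commutatorProduct G m ≤ mooreBoundary G (m + 1) := by
  refine iSup_le fun I => iSup_le fun J => iSup_le fun hI => iSup_le fun hJ =>
    iSup_le fun hIJ => ?_
  obtain ⟨I', hI', J', hJ', h₁, h₂, h₃⟩ := exists_proper_cover hI hJ hIJ
  exact (Subgroup.commutator_mono (faceKer_anti hI') (faceKer_anti hJ')).trans
    (commutator_faceKer_le_of_ne_univ h₁ h₂ h₃)

end SimplicialGroup

/-- Here the dimension is `n = m + 2 ≥ 2`, so that `n - 1 = m + 1`: if `G_n` is generated by its
degenerate elements, then `d(N_n G)` is the product of the commutator subgroups `[K_I, K_J]`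
of `G_{n-1}`. -/
theorem theorem6 (G : SimplicialObject GrpCat.{u}) (m : ℕ)
    (hG : SimplicialGroup.degenerateSubgroup G (m + 1) = ⊤) :
    SimplicialGroup.mooreBoundary G (m + 1) = SimplicialGroup.commutatorProduct G m := by
  exact le_antisymm (SimplicialGroup.mooreBoundary_le hG) SimplicialGroup.commutatorProduct_le
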